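/- Let $M\ge 1$ be an integer such that the part size $M+1$ is congruent to $1$ or $4$ modulo $5$, let $t$ be an indeterminate and write $[M+1]_q=1+q+\cdots+q^M$. Then, as an identity of formal power series in $q$ with coefficients in $\mathbb{Z}[t]$ (the infinite sum and the infinite product converge coefficientwise), $$ \begin{aligned} 1&+q\,\frac{1+q+\cdots+q^{M-1}+tq^{M}}{1-tq^{M+1}} +\sum_{k=2}^{M} q^{k^2}\,\frac{[M+1]_q}{1-tq^{M+1}}\,\frac{1}{(1-q^2)(1-q^3)\cdots(1-q^k)}\\ &+\sum_{k=M+1}^{\infty}\frac{q^{k^2}}{(1-q)\cdots(1-q^M)\,(1-tq^{M+1})\,(1-q^{M+2})\cdots(1-q^k)}\\ &=\frac{1-q^{M+1}}{1-tq^{M+1}}\;\frac{1}{\prod_{n=0}^{\infty}(1-q^{5n+1})(1-q^{5n+4})}. \end{aligned} $$ -/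

import Mathlib

open scoped Polynomial PowerSeries PowerSeries.WithPiTopology

namespace RogersRamanujan

/-- The discrete topology on the coefficient ring `ℤ[t]`. Together with the (scoped) product
topology on power series it makes limits in `ℤ[t]⟦q⟧` the usual formal ones: every coefficient
of the partial sums or products is eventually constant. -/
abbrev coeffTopology : TopologicalSpace ℤ[X] := ⊥

/-- The formal variable `q` of `ℤ[t]⟦q⟧`. -/
noncomputable def q : ℤ[X]⟦X⟧ := PowerSeries.X

/-- The weight `t`, an indeterminate, as a constant of `ℤ[t]⟦q⟧`. -/
noncomputable def t : ℤ[X]⟦X⟧ := PowerSeries.C Polynomial.X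

/-- The reciprocal `1 / f` of a formal power series `f` with constant coefficient `1`. -/
noncomputable def recip (f : ℤ[X]⟦X⟧) : ℤ[X]⟦X⟧ := PowerSeries.invOfUnit f 1

theorem mul_recip (f : ℤ[X]⟦X⟧) (hf : PowerSeries.constantCoeff f = 1) : f * recip f = 1 :=
  PowerSeries.mul_invOfUnit f 1 (by simpa using hf)

/-- The `q`-integer `[n]_q = 1 + q + ⋯ + q ^ (n - 1)`. -/
noncomputable def qInt (n : ℕ) : ℤ[X]⟦X⟧ := ∑ i ∈ Finset.range n, q ^ i

/-- The summand of index `k ≥ M + 1`: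
`q ^ (k²) / ((1 - q) ⋯ (1 - q ^ M) (1 - t q ^ (M+1)) (1 - q ^ (M+2)) ⋯ (1 - q ^ k))`. -/
noncomputable def tailTerm (M k : ℕ) : ℤ[X]⟦X⟧ :=
  q ^ (k ^ 2) * recip ((∏ i ∈ Finset.Icc 1 M, (1 - q ^ i)) * (1 - t * q ^ (M + 1)) *
    ∏ i ∈ Finset.Icc (M + 2) k, (1 - q ^ i))

/-- The factor `(1 - q ^ (5n+1)) (1 - q ^ (5n+4))` of the product side. -/
noncomputable def prodFactor (n : ℕ) : ℤ[X]⟦X⟧ :=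
  (1 - q ^ (5 * n + 1)) * (1 - q ^ (5 * n + 4))

end RogersRamanujan

/-! Every summand on the left is $c=(1-q^{M+1})/(1-tq^{M+1})$ times a Rogers-Ramanujan summand
$q^{k^2}/(q)_k$, where $(q)_k=(1-q)\cdots(1-q^k)$; the first two displayed terms jointly give
$k=0,1$. So the claim is $c$ times the first Rogers-Ramanujan identity. That identity comes from the
Bailey chain. At $z=1$ the finite triple product `sum_thetaTerm` vanishes for $n\ge1$, which is the
unit Bailey pair. Two applications of `bailey` give the finite identity `rogersRamanujan`. Modulo
$q^{n+1}$ its theta side is evaluated by `sum_thetaTerm` in base $q^5$, and $n\to\infty$ finishes.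
-/

namespace RogersRamanujan

/-! ### Finite identities: Bailey lemma and triple product. -/

section Finite

variable {R : Type*} [CommRing R]

/-- `G (m + 1)` is the reciprocal of `(1 - Q) (1 - Q ^ 2) ⋯ (1 - Q ^ m)`, and `G 0 = 0`. -/
structure IsInvPochhammer (Q : R) (G : ℕ → R) : Prop where
  zero : G 0 = 0
  one : G 1 = 1
  step : ∀ m, (1 - Q ^ m) * G (m + 1) = G m

/-- The limiting case of the `q`-Vandermonde convolution. -/
theorem IsInvPochhammer.vandermonde [IsDomain R] {Q : R} {G : ℕ → R} (hG : IsInvPochhammer Q G)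
    (hQ : ∀ m, 1 - Q ^ (m + 1) ≠ 0) (m r : ℕ) :
    ∑ j ∈ Finset.range (m + 1), Q ^ (j * (j + r)) * (G (m + 1 - j) * G (j + 1) * G (j + r + 1))
      = G (m + 1) * G (m + r + 1) := by
  induction m generalizing r with
  | zero => simp [hG.one]
  | succ m ih =>
    -- Split $1-Q^{m+1}=(1-Q^{m+1-j})+Q^{m+1-j}(1-Q^j)$: the first piece is the case $(m,r)$, the
    -- second, after shifting $j$, the case $(m,r+1)$.
    apply mul_left_cancel₀ (hQ m)
    have h1 : ∑ j ∈ Finset.range (m + 2),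
        Q ^ (j * (j + r)) * (G (m + 1 - j) * G (j + 1) * G (j + r + 1))
          = G (m + 1) * G (m + r + 1) := by
      rw [Finset.sum_range_succ, ih r]
      simp [hG.zero]
    have h2 : ∑ j ∈ Finset.range (m + 2), Q ^ (m + 1 - j) *
        (Q ^ (j * (j + r)) * (G (m + 1 + 1 - j) * G j * G (j + r + 1)))
          = Q ^ (m + r + 1) * (G (m + 1) * G (m + (r + 1) + 1)) := by
      rw [Finset.sum_range_succ', ← ih (r + 1), Finset.mul_sum]
      simp only [hG.zero, mul_zero, zero_mul, add_zero]
      refine Finset.sum_congr rfl fun j hj => ?_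
      obtain ⟨d, rfl⟩ := Nat.exists_eq_add_of_le (Finset.mem_range_succ_iff.mp hj)
      rw [show j + d + 1 - (j + 1) = d by lia, show j + d + 1 + 1 - (j + 1) = d + 1 by lia,
        show j + d + 1 - j = d + 1 by lia, show j + 1 + r + 1 = j + (r + 1) + 1 by lia]
      ring
    have h3 : (1 - Q ^ (m + 1)) * ∑ j ∈ Finset.range (m + 2),
        Q ^ (j * (j + r)) * (G (m + 1 + 1 - j) * G (j + 1) * G (j + r + 1))
          = G (m + 1) * G (m + r + 1) + Q ^ (m + r + 1) * (G (m + 1) * G (m + (r + 1) + 1)) := by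
      rw [← h1, ← h2, ← Finset.sum_add_distrib, Finset.mul_sum]
      refine Finset.sum_congr rfl fun j hj => ?_
      obtain ⟨d, hd⟩ := Nat.exists_eq_add_of_le (Finset.mem_range_succ_iff.mp hj)
      rw [hd, show j + d + 1 - j = d + 1 by lia, show j + d - j = d by lia, ← hG.step j,
        ← hG.step d]
      ring
    rw [h3, ← hG.step (m + r + 1), ← mul_assoc _ (G (m + 1 + 1)), hG.step (m + 1),
      show m + (r + 1) + 1 = m + r + 1 + 1 by lia, show m + 1 + r + 1 = m + r + 1 + 1 by lia]
    ring

/-- The case of the Bailey lemma relative to `a = 1` in which both parameters tend to infinity. -/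
theorem IsInvPochhammer.bailey [IsDomain R] {Q : R} {G : ℕ → R} (hG : IsInvPochhammer Q G)
    (hQ : ∀ m, 1 - Q ^ (m + 1) ≠ 0) (α : ℕ → R) (n : ℕ) :
    ∑ s ∈ Finset.range (n + 1), Q ^ (s ^ 2) * G (n + 1 - s) *
        ∑ k ∈ Finset.range (s + 1), α k * (G (s + 1 - k) * G (s + 1 + k))
      = ∑ k ∈ Finset.range (n + 1), Q ^ (k ^ 2) * α k * (G (n + 1 - k) * G (n + 1 + k)) := by
  simp_rw [Finset.mul_sum]
  rw [Finset.sum_comm' (t' := Finset.range (n + 1)) (s' := fun k => Finset.Ico k (n + 1))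
    (by intro x y; simp only [Finset.mem_range, Finset.mem_Ico]; lia)]
  refine Finset.sum_congr rfl fun k hk => ?_
  obtain ⟨m, rfl⟩ := Nat.exists_eq_add_of_le (Finset.mem_range_succ_iff.mp hk)
  have h := hG.vandermonde hQ m (2 * k)
  rw [Finset.sum_Ico_eq_sum_range, show k + m + 1 - k = m + 1 by lia,
    show k + m + 1 + k = m + 2 * k + 1 by lia, ← h, Finset.mul_sum]
  refine Finset.sum_congr rfl fun j hj => ?_
  rw [show k + m + 1 - (k + j) = m + 1 - j by lia, show k + j + 1 - k = j + 1 by lia,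
    show k + j + 1 + k = j + 2 * k + 1 by lia]
  ring

/-- The sum of the terms of index `k` and `-k` of the theta series
`∑ (-1) ^ k z ^ k (z w) ^ (k (k - 1) / 2)`; for `k = 0` it counts the term twice. -/
def thetaPair (z w : R) (k : ℕ) : R := (-1) ^ k * (z ^ k + w ^ k) * (z * w) ^ k.choose 2

/-- The theta series folded to nonnegative indices. -/
def thetaTerm (z w : R) (k : ℕ) : R := if k = 0 then 1 else thetaPair z w k

theorem thetaPair_rec (z w : R) (k : ℕ) :
    thetaPair z w (k + 2) + (z * w) ^ (2 * k + 2) * thetaPair z w k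
      = -(z + w) * (z * w) ^ (k + 1) * thetaPair z w (k + 1) := by
  have h1 : (k + 1).choose 2 = k + k.choose 2 := by simp [Nat.choose_succ_succ' k 1]
  have h2 : (k + 2).choose 2 = 2 * k + 1 + k.choose 2 := by
    simp [Nat.choose_succ_succ' (k + 1) 1, h1]; ring
  rw [thetaPair, thetaPair, thetaPair, h1, h2]
  ring

/-- Two $q$-Pascal steps, from row $2n$ to row $2n+2$, with binomials divided by their top
factorial. Truncation of `c - 1` at `c = 0` is harmless since `G 0 = 0`. -/
theorem IsInvPochhammer.three_term {Q : R} {G : ℕ → R} (hG : IsInvPochhammer Q G) (c d : ℕ) :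
    (1 - Q ^ (c + d)) * (1 - Q ^ (c + d + 1)) * (G (c + 1) * G (d + 2))
      = (1 + Q ^ (c + d)) * (G c * G (d + 1)) + Q ^ c * (G (c + 1) * G d)
        + Q ^ (d + 1) * (G (c - 1) * G (d + 2)) := by
  cases c with
  | zero =>
    rw [← hG.step d, ← hG.step (d + 1)]
    simp only [hG.zero, Nat.zero_sub]
    ring
  | succ c =>
    rw [Nat.add_sub_cancel, ← hG.step c, ← hG.step d, ← hG.step (c + 1), ← hG.step (d + 1)]
    ring

/-- The finite form of the Jacobi triple product identity, folded to nonnegative indices. -/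
theorem IsInvPochhammer.sum_thetaTerm [IsDomain R] {z w : R} {G : ℕ → R}
    (hG : IsInvPochhammer (z * w) G) (hQ : ∀ m, 1 - (z * w) ^ (m + 1) ≠ 0) (n : ℕ) :
    ∑ k ∈ Finset.range (n + 1), thetaTerm z w k * (G (n + 1 - k) * G (n + 1 + k))
      = (∏ i ∈ Finset.range n, (1 - z * (z * w) ^ i) * (1 - w * (z * w) ^ i))
        * G (2 * n + 1) := by
  have hsplit : ∀ n, ∑ k ∈ Finset.range (n + 1), thetaTerm z w k * (G (n + 1 - k) * G (n + 1 + k))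
      = G (n + 1) * G (n + 1)
        + ∑ k ∈ Finset.range n, thetaPair z w (k + 1) * (G (n - k) * G (n + k + 2)) := by
    intro n
    rw [Finset.sum_range_succ', add_comm]
    simp [thetaTerm, add_assoc, add_comm, add_left_comm]
  simp only [hsplit]
  set Q := z * w with hQdef
  induction n with
  | zero => simp [hG.one]
  | succ n ih =>
    -- `three_term` reduces row $n+1$ to row $n$; after reindexing, `thetaPair_rec` merges the
    -- neighbours into the new factor $(1-zQ^n)(1-wQ^n)$.
    apply mul_left_cancel₀ (mul_ne_zero (hQ (2 * n)) (hQ (2 * n + 1)))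
    set a := thetaPair z w with ha
    have hterm : ∀ k ∈ Finset.range (n + 1),
        (1 - Q ^ (2 * n + 1)) * (1 - Q ^ (2 * n + 2)) * (a (k + 1) * (G (n + 1 - k) * G (n + 1 + k + 2)))
          = (1 + Q ^ (2 * n + 1)) * (a (k + 1) * (G (n - k) * G (n + k + 2)))
            + a (k + 1) * (Q ^ (n - k) * (G (n + 1 - k) * G (n + k + 1)))
            + a (k + 1) * (Q ^ (n + k + 2) * (G (n - (k + 1)) * G (n + (k + 1) + 2))) := by
      intro k hk
      obtain ⟨c, rfl⟩ := Nat.exists_eq_add_of_le (Finset.mem_range_succ_iff.mp hk)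
      have h := hG.three_term c (k + c + k + 1)
      rw [show k + c + 1 - k = c + 1 by lia, show k + c - k = c by lia,
        show k + c - (k + 1) = c - 1 by lia]
      rw [show c + (k + c + k + 1) = 2 * (k + c) + 1 by lia] at h
      rw [show k + c + 1 + k + 2 = k + c + k + 1 + 2 by lia,
        show k + c + (k + 1) + 2 = k + c + k + 1 + 2 by lia]
      linear_combination a (k + 1) * h
    have hzero : (1 - Q ^ (2 * n + 1)) * (1 - Q ^ (2 * n + 2)) * (G (n + 2) * G (n + 2))
        = (1 + Q ^ (2 * n + 1)) * (G (n + 1) * G (n + 1)) + 2 * (Q ^ (n + 1) * (G n * G (n + 2))) := by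
      have h := hG.three_term (n + 1) n
      rw [show n + 1 + n = 2 * n + 1 by lia, Nat.add_sub_cancel] at h
      linear_combination h
    have hA : ∑ k ∈ Finset.range (n + 1), a (k + 1) * (G (n - k) * G (n + k + 2))
        = ∑ k ∈ Finset.range n, a (k + 1) * (G (n - k) * G (n + k + 2)) := by
      rw [Finset.sum_range_succ]; simp [hG.zero]
    have hB : ∑ k ∈ Finset.range (n + 1), a (k + 1) * (Q ^ (n - k) * (G (n + 1 - k) * G (n + k + 1)))
        = a 1 * (Q ^ n * (G (n + 1) * G (n + 1)))
          + ∑ k ∈ Finset.range n, a (k + 2) * (Q ^ (n - (k + 1)) * (G (n - k) * G (n + k + 2))) := by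
      rw [Finset.sum_range_succ', add_comm]
      simp [add_assoc, add_comm, add_left_comm]
    have hC : ∑ k ∈ Finset.range (n + 1),
          a (k + 1) * (Q ^ (n + k + 2) * (G (n - (k + 1)) * G (n + (k + 1) + 2)))
          + 2 * (Q ^ (n + 1) * (G n * G (n + 2)))
        = ∑ k ∈ Finset.range n, a k * (Q ^ (n + k + 1) * (G (n - k) * G (n + k + 2))) := by
      -- The doubled value at $0$ absorbs the equal contributions of $k=\pm1$ to the central term.
      have h0 : a 0 = 2 := by simp [ha, thetaPair]; norm_num
      have h := Finset.sum_range_succ'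
        (fun k => a k * (Q ^ (n + k + 1) * (G (n - k) * G (n + k + 2)))) (n + 1)
      rw [Finset.sum_range_succ, Finset.sum_range_succ] at h
      simp only [Nat.sub_self, show n - (n + 1) = 0 by lia, hG.zero, zero_mul, mul_zero, add_zero,
        Nat.sub_zero, h0] at h
      rw [h]
      simp only [add_assoc, add_comm, add_left_comm, Nat.reduceAdd]
    have hD : ∑ k ∈ Finset.range n, a (k + 2) * (Q ^ (n - (k + 1)) * (G (n - k) * G (n + k + 2)))
          + ∑ k ∈ Finset.range n, a k * (Q ^ (n + k + 1) * (G (n - k) * G (n + k + 2)))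
        = -(z + w) * Q ^ n * ∑ k ∈ Finset.range n, a (k + 1) * (G (n - k) * G (n + k + 2)) := by
      rw [← Finset.sum_add_distrib, Finset.mul_sum]
      refine Finset.sum_congr rfl fun k hk => ?_
      obtain ⟨c, rfl⟩ := Nat.exists_eq_add_of_lt (Finset.mem_range.mp hk)
      have h := thetaPair_rec z w k
      rw [← hQdef, ← ha] at h
      rw [show k + c + 1 - (k + 1) = c by lia]
      linear_combination Q ^ c * (G (k + c + 1 - k) * G (k + c + 1 + k + 2)) * h
    have ha1 : a 1 = -(z + w) := by simp [ha, thetaPair]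
    have hstep : (1 - Q ^ (2 * n + 1)) * (1 - Q ^ (2 * n + 2)) * G (2 * (n + 1) + 1)
        = G (2 * n + 1) := by
      rw [← hG.step (2 * n + 1), ← hG.step (2 * n + 1 + 1), mul_assoc]
      rfl
    rw [mul_add, hzero, Finset.mul_sum, Finset.sum_congr rfl hterm, Finset.sum_add_distrib,
      Finset.sum_add_distrib, ← Finset.mul_sum, hA, hB, Finset.prod_range_succ]
    rw [ha1]
    have hQn : Q ^ (2 * n + 1) = z * w * Q ^ n * Q ^ n := by rw [hQdef]; ring
    rw [hQn] at hstep ⊢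
    linear_combination hC + hD + (1 - (z + w) * Q ^ n + z * w * Q ^ n * Q ^ n) * ih
      - (∏ i ∈ Finset.range n, (1 - z * Q ^ i) * (1 - w * Q ^ i)) *
        (1 - z * Q ^ n) * (1 - w * Q ^ n) * hstep

/-- Each Bailey step contributes one factor $x^{k^2}$. -/
theorem thetaTerm_sq_cube (x : R) (k : ℕ) :
    thetaTerm (x ^ 2) (x ^ 3) k = x ^ (k ^ 2) * (x ^ (k ^ 2) * thetaTerm 1 x k) := by
  unfold thetaTerm
  split_ifs with h
  · simp [h]
  have hk : k ^ 2 = 2 * k.choose 2 + k := by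
    rw [Nat.choose_two_right, Nat.mul_div_cancel' (Nat.even_mul_pred_self k).two_dvd]
    obtain ⟨m, rfl⟩ := Nat.exists_eq_succ_of_ne_zero h
    simp; ring
  rw [thetaPair, thetaPair, hk]
  ring

/-- A finite form of the first Rogers-Ramanujan identity. -/
theorem IsInvPochhammer.rogersRamanujan [IsDomain R] {x : R} {G : ℕ → R}
    (hG : IsInvPochhammer x G) (hx : ∀ m, 1 - x ^ (m + 1) ≠ 0) (n : ℕ) :
    ∑ s ∈ Finset.range (n + 1), x ^ (s ^ 2) * G (n + 1 - s) * G (s + 1)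
      = ∑ k ∈ Finset.range (n + 1),
          thetaTerm (x ^ 2) (x ^ 3) k * (G (n + 1 - k) * G (n + 1 + k)) := by
  have h0 : ∀ n, ∑ k ∈ Finset.range (n + 1), thetaTerm 1 x k * (G (n + 1 - k) * G (n + 1 + k))
      = if n = 0 then 1 else 0 := by
    intro n
    rw [IsInvPochhammer.sum_thetaTerm (z := 1) (w := x) (G := G) (by simpa using hG)
      (by simpa using hx)]
    rcases n with _ | n
    · simp [hG.one]
    -- The factor $1-z$ at $i=0$ vanishes.
    · simp [Finset.prod_range_succ']
  have h1 : ∀ n, ∑ k ∈ Finset.range (n + 1),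
      x ^ (k ^ 2) * thetaTerm 1 x k * (G (n + 1 - k) * G (n + 1 + k)) = G (n + 1) := by
    intro n
    rw [← hG.bailey hx]
    simp [h0]
  simp only [thetaTerm_sq_cube]
  rw [← hG.bailey hx (fun k => x ^ (k ^ 2) * thetaTerm 1 x k)]
  refine Finset.sum_congr rfl fun s _ => ?_
  rw [h1]

end Finite

end RogersRamanujan

/-! ### Truncation modulo powers of $x$. -/

namespace RogersRamanujan

section Congruence

variable {R : Type*} [CommRing R]

theorem IsInvPochhammer.prod_mul {Q : R} {G : ℕ → R} (hG : IsInvPochhammer Q G) (m : ℕ) :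
    (∏ i ∈ Finset.range m, (1 - Q ^ (i + 1))) * G (m + 1) = 1 := by
  induction m with
  | zero => simp [hG.one]
  | succ m ih => rw [Finset.prod_range_succ, mul_assoc, hG.step, ih]

theorem IsInvPochhammer.dvd_succ_sub_succ {x Q : R} {G : ℕ → R} (hG : IsInvPochhammer Q G) (hx : x ∣ Q)
    {m n : ℕ} (hmn : m ≤ n) : x ^ (m + 1) ∣ G (n + 1) - G (m + 1) := by
  induction n, hmn using Nat.le_induction with
  | base => simp
  | succ n hmn ih =>
    have h : x ^ (m + 1) ∣ Q ^ (n + 1) :=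
      (pow_dvd_pow_of_dvd hx _).trans (pow_dvd_pow _ (by lia))
    have h2 : G (n + 1 + 1) - G (m + 1)
        = Q ^ (n + 1) * G (n + 1 + 1) + (G (n + 1) - G (m + 1)) := by
      rw [← hG.step (n + 1)]; ring
    exact h2 ▸ dvd_add (h.mul_right _) ih

/-- The $k$ orders of precision lost in the index are regained from $x^k\mid c$. -/
theorem IsInvPochhammer.dvd_mul_sub {x Q c : R} {G : ℕ → R} (hG : IsInvPochhammer Q G)
    (hx : x ∣ Q) {k n : ℕ} (hk : k ≤ n) (hc : x ^ k ∣ c) :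
    x ^ (n + 1) ∣ c * G (n + 1 - k) - c * G (n + 1) := by
  obtain ⟨m, rfl⟩ := Nat.exists_eq_add_of_le hk
  rw [← mul_sub, show k + m + 1 = k + (m + 1) by lia, pow_add, Nat.add_sub_cancel_left,
    ← dvd_neg, ← mul_neg, neg_sub]
  exact mul_dvd_mul hc (hG.dvd_succ_sub_succ hx (by lia))

theorem IsInvPochhammer.dvd_mul_mul_sub {x Q c : R} {G : ℕ → R} (hG : IsInvPochhammer Q G)
    (hx : x ∣ Q) {k n : ℕ} (hk : k ≤ n) (hc : x ^ k ∣ c) :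
    x ^ (n + 1) ∣ c * (G (n + 1 - k) * G (n + 1 + k)) - c * (G (n + 1) * G (n + 1)) := by
  have h1 := (hG.dvd_mul_sub hx hk hc).mul_right (G (n + 1 + k))
  have h2 := (hG.dvd_succ_sub_succ hx (Nat.le_add_right n k)).mul_left (c * G (n + 1))
  rw [show n + k + 1 = n + 1 + k by lia] at h2
  convert dvd_add h1 h2 using 1
  ring

theorem dvd_thetaTerm (x : R) (k : ℕ) : x ^ k ∣ thetaTerm (x ^ 2) (x ^ 3) k := by
  rw [thetaTerm_sq_cube]
  exact (pow_dvd_pow x (Nat.le_self_pow two_ne_zero k)).mul_right _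

theorem prod_range_five_mul (x : R) (n : ℕ) :
    (∏ i ∈ Finset.range n, (1 - x ^ 2 * (x ^ 5) ^ i) * (1 - x ^ 3 * (x ^ 5) ^ i))
      * (∏ i ∈ Finset.range n, (1 - (x ^ 5) ^ (i + 1)))
      * (∏ i ∈ Finset.range n, (1 - x ^ (5 * i + 1)) * (1 - x ^ (5 * i + 4)))
      = ∏ i ∈ Finset.range (5 * n), (1 - x ^ (i + 1)) := by
  induction n with
  | zero => simp
  | succ n ih =>
    rw [show 5 * (n + 1) = 5 * n + 1 + 1 + 1 + 1 + 1 by lia]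
    simp only [Finset.prod_range_succ]
    rw [← ih]
    ring

/-- The first Rogers-Ramanujan identity modulo `x ^ (n + 1)`. -/
theorem IsInvPochhammer.dvd_rogersRamanujan [IsDomain R] {x : R} {G H : ℕ → R}
    (hG : IsInvPochhammer x G) (hH : IsInvPochhammer (x ^ 5) H)
    (hx : ∀ m, 1 - x ^ (m + 1) ≠ 0) (n : ℕ) :
    x ^ (n + 1) ∣ (∑ s ∈ Finset.range (n + 1), x ^ (s ^ 2) * G (s + 1))
      * (∏ i ∈ Finset.range n, (1 - x ^ (5 * i + 1)) * (1 - x ^ (5 * i + 4))) - 1 := by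
  have hx5 : x ∣ x ^ 5 := dvd_pow_self x (by norm_num)
  have hQ : x ^ 2 * x ^ 3 = x ^ 5 := by ring
  have hsum : x ^ (n + 1) ∣
      (∑ k ∈ Finset.range (n + 1), thetaTerm (x ^ 2) (x ^ 3) k) * (G (n + 1) * G (n + 1))
      - (∑ s ∈ Finset.range (n + 1), x ^ (s ^ 2) * G (s + 1)) * G (n + 1) := by
    have h1 : x ^ (n + 1) ∣ ∑ s ∈ Finset.range (n + 1),
        (x ^ (s ^ 2) * G (s + 1) * G (n + 1 - s) - x ^ (s ^ 2) * G (s + 1) * G (n + 1)) :=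
      Finset.dvd_sum fun s hs => hG.dvd_mul_sub dvd_rfl (Finset.mem_range_succ_iff.mp hs)
        ((pow_dvd_pow x (Nat.le_self_pow two_ne_zero s)).mul_right _)
    have h2 : x ^ (n + 1) ∣ ∑ k ∈ Finset.range (n + 1),
        (thetaTerm (x ^ 2) (x ^ 3) k * (G (n + 1 - k) * G (n + 1 + k))
          - thetaTerm (x ^ 2) (x ^ 3) k * (G (n + 1) * G (n + 1))) :=
      Finset.dvd_sum fun k hk => hG.dvd_mul_mul_sub dvd_rfl (Finset.mem_range_succ_iff.mp hk)
        (dvd_thetaTerm x k)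
    rw [Finset.sum_sub_distrib, ← Finset.sum_mul] at h1 h2
    rw [← hG.rogersRamanujan hx] at h2
    simp only [mul_right_comm _ (G (_ + 1)) (G (_ - _))] at h1
    convert dvd_sub h1 h2 using 1
    ring
  have htheta : x ^ (n + 1) ∣
      (∏ i ∈ Finset.range n, (1 - x ^ 2 * (x ^ 5) ^ i) * (1 - x ^ 3 * (x ^ 5) ^ i)) * H (n + 1)
      - (∑ k ∈ Finset.range (n + 1), thetaTerm (x ^ 2) (x ^ 3) k) * (H (n + 1) * H (n + 1)) := by
    have h1 : x ^ (n + 1) ∣ ∑ k ∈ Finset.range (n + 1),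
        (thetaTerm (x ^ 2) (x ^ 3) k * (H (n + 1 - k) * H (n + 1 + k))
          - thetaTerm (x ^ 2) (x ^ 3) k * (H (n + 1) * H (n + 1))) :=
      Finset.dvd_sum fun k hk => hH.dvd_mul_mul_sub hx5 (Finset.mem_range_succ_iff.mp hk)
        (dvd_thetaTerm x k)
    rw [Finset.sum_sub_distrib, ← Finset.sum_mul, IsInvPochhammer.sum_thetaTerm (hQ.symm ▸ hH)
      (fun m => by rw [hQ, ← pow_mul]; exact hx (5 * m + 4)), hQ] at h1
    have h2 := (hH.dvd_succ_sub_succ hx5 (show n ≤ 2 * n by lia)).mul_left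
      (∏ i ∈ Finset.range n, (1 - x ^ 2 * (x ^ 5) ^ i) * (1 - x ^ 3 * (x ^ 5) ^ i))
    convert dvd_sub h1 h2 using 1
    ring
  have hlast := hG.dvd_succ_sub_succ (dvd_refl x) (show n ≤ 5 * n by lia)
  have hP := hG.prod_mul n
  have hP5 := hG.prod_mul (5 * n)
  have hPH := hH.prod_mul n
  have hprod := prod_range_five_mul x n
  obtain ⟨a, ha⟩ := hsum
  obtain ⟨b, hb⟩ := htheta
  obtain ⟨c, hc⟩ := hlast
  generalize (∑ k ∈ Finset.range (n + 1), thetaTerm (x ^ 2) (x ^ 3) k) = θ at *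
  generalize (∑ s ∈ Finset.range (n + 1), x ^ (s ^ 2) * G (s + 1)) = S at *
  generalize (∏ i ∈ Finset.range n, (1 - x ^ 2 * (x ^ 5) ^ i) * (1 - x ^ 3 * (x ^ 5) ^ i)) = A at *
  generalize (∏ i ∈ Finset.range n, (1 - (x ^ 5) ^ (i + 1))) = B at *
  generalize (∏ i ∈ Finset.range n, (1 - x ^ (5 * i + 1)) * (1 - x ^ (5 * i + 4))) = C at *
  generalize (∏ i ∈ Finset.range n, (1 - x ^ (i + 1))) = P at *
  -- `P` and `B` invert `G (n + 1)` and `H (n + 1)`, so both congruences can be solved exactly for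
  -- `S` and `θ`.
  have e1 : S = θ * G (n + 1) - P * (x ^ (n + 1) * a) := by
    linear_combination (-P) * ha + (θ * G (n + 1) - S) * hP
  have e2 : θ = A * B - B * B * (x ^ (n + 1) * b) := by
    linear_combination (-B * B) * hb + (A * B - θ * (B * H (n + 1) + 1)) * hPH
  have e3 : A * B * C * G (5 * n + 1) = 1 := by rw [hprod, hP5]
  refine ⟨-(C * P * a) - B * B * b * G (n + 1) * C - A * B * C * c, ?_⟩
  rw [e1]
  linear_combination C * G (n + 1) * e2 + e3 - A * B * C * hc

end Congruence

/-! ### Power series and passage to the limit. -/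

section Series

theorem constantCoeff_q_pow (n : ℕ) : PowerSeries.constantCoeff (q ^ (n + 1)) = 0 := by
  simp [q]

theorem one_sub_q_pow_ne_zero (n : ℕ) : 1 - q ^ (n + 1) ≠ 0 := fun h => by
  simpa [q] using congrArg PowerSeries.constantCoeff h

theorem eq_recip {f g : ℤ[X]⟦X⟧} (h : f * g = 1) (hf : PowerSeries.constantCoeff f = 1) :
    g = recip f := by
  linear_combination recip f * h - g * mul_recip f hf

/-- `invPochhammer Q (m + 1) = 1 / ((1 - Q) ⋯ (1 - Q ^ m))`. -/
noncomputable def invPochhammer (Q : ℤ[X]⟦X⟧) : ℕ → ℤ[X]⟦X⟧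
  | 0 => 0
  | m + 1 => recip (∏ i ∈ Finset.range m, (1 - Q ^ (i + 1)))

theorem isInvPochhammer_invPochhammer {Q : ℤ[X]⟦X⟧} (hQ : PowerSeries.constantCoeff Q = 0) :
    IsInvPochhammer Q (invPochhammer Q) := by
  have hc : ∀ m, PowerSeries.constantCoeff (∏ i ∈ Finset.range m, (1 - Q ^ (i + 1))) = 1 := by
    intro m
    simp [map_prod, hQ]
  refine ⟨rfl, (eq_recip (by simp) (hc 0)).symm, fun m => ?_⟩
  cases m with
  | zero => simp [invPochhammer]
  | succ m =>
    refine eq_recip ?_ (hc m)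
    rw [← mul_assoc, ← Finset.prod_range_succ]
    exact mul_recip _ (hc (m + 1))

/-- The summand `q ^ (k²) / ((1 - q) ⋯ (1 - q ^ k))` of the first Rogers-Ramanujan identity. -/
noncomputable def rrTerm (k : ℕ) : ℤ[X]⟦X⟧ := q ^ (k ^ 2) * invPochhammer q (k + 1)

theorem isInvPochhammer_q : IsInvPochhammer q (invPochhammer q) :=
  isInvPochhammer_invPochhammer (by simp [q])

theorem prod_Icc_mul_invPochhammer (k : ℕ) :
    (∏ i ∈ Finset.Icc 1 k, (1 - q ^ i)) * invPochhammer q (k + 1) = 1 := by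
  refine Eq.trans ?_ (isInvPochhammer_q.prod_mul k)
  rw [Finset.range_eq_Ico, Finset.prod_Ico_add' (fun i => 1 - q ^ i), zero_add,
    Finset.Ico_add_one_right_eq_Icc]

theorem constantCoeff_prod_Icc (a k : ℕ) :
    PowerSeries.constantCoeff (∏ i ∈ Finset.Icc (a + 1) k, (1 - q ^ i)) = 1 := by
  rw [map_prod]
  refine Finset.prod_eq_one fun i hi => ?_
  have : i ≠ 0 := by have := Finset.mem_Icc.mp hi; lia
  simp [q, this]

theorem constantCoeff_one_sub_t (M : ℕ) :
    PowerSeries.constantCoeff (1 - t * q ^ (M + 1)) = 1 := by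
  simp [q]

theorem tailTerm_eq (M j : ℕ) :
    tailTerm M (M + 1 + j)
      = (1 - q ^ (M + 1)) * recip (1 - t * q ^ (M + 1)) * rrTerm (M + 1 + j) := by
  have h : (∏ i ∈ Finset.Icc 1 (M + 1 + j), (1 - q ^ i)) = (∏ i ∈ Finset.Icc 1 M, (1 - q ^ i))
      * (1 - q ^ (M + 1)) * ∏ i ∈ Finset.Icc (M + 2) (M + 1 + j), (1 - q ^ i) := by
    rw [← Finset.prod_Icc_succ_top (show 1 ≤ M + 1 by lia)]
    simp only [← Finset.Ico_add_one_right_eq_Icc]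
    exact (Finset.prod_Ico_consecutive _ (by lia) (by lia)).symm
  have h1 := prod_Icc_mul_invPochhammer (M + 1 + j)
  have h2 := mul_recip _ (constantCoeff_one_sub_t M)
  rw [tailTerm, rrTerm, ← eq_recip (g := (1 - q ^ (M + 1)) * recip (1 - t * q ^ (M + 1))
    * invPochhammer q (M + 1 + j + 1))]
  · ring
  · rw [h] at h1
    linear_combination (1 - t * q ^ (M + 1)) * recip (1 - t * q ^ (M + 1)) * h1 + h2
  · rw [map_mul, map_mul, constantCoeff_prod_Icc 0, constantCoeff_prod_Icc (M + 1),
      constantCoeff_one_sub_t, one_mul, one_mul]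

theorem qInt_mul (n : ℕ) : qInt n * (1 - q) = 1 - q ^ n := geom_sum_mul_neg q n

theorem middleTerm_eq (M k : ℕ) (hk : 2 ≤ k) :
    q ^ (k ^ 2) * (qInt (M + 1) * recip (1 - t * q ^ (M + 1)))
        * recip (∏ i ∈ Finset.Icc 2 k, (1 - q ^ i))
      = (1 - q ^ (M + 1)) * recip (1 - t * q ^ (M + 1)) * rrTerm k := by
  have h : (∏ i ∈ Finset.Icc 1 k, (1 - q ^ i))
      = (1 - q) * ∏ i ∈ Finset.Icc 2 k, (1 - q ^ i) := by
    rw [← Finset.mul_prod_Ioc_eq_prod_Icc (by lia), pow_one]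
    rfl
  have h1 := prod_Icc_mul_invPochhammer k
  rw [h] at h1
  rw [rrTerm, ← eq_recip (g := (1 - q) * invPochhammer q (k + 1)) (by linear_combination h1)
    (constantCoeff_prod_Icc 1 k), ← qInt_mul]
  ring

/-- The terms in $t$ cancel in the numerator, leaving $[M+1]_q/(1-tq^{M+1})$, while
$1+q/(1-q)=1/(1-q)$. -/
theorem initialTerms_eq (M : ℕ) :
    1 + q * ((∑ i ∈ Finset.range M, q ^ i) + t * q ^ M) * recip (1 - t * q ^ (M + 1))
      = (1 - q ^ (M + 1)) * recip (1 - t * q ^ (M + 1)) * (rrTerm 0 + rrTerm 1) := by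
  have h1 := isInvPochhammer_q.step 1
  have h2 := mul_recip _ (constantCoeff_one_sub_t M)
  have h3 := geom_sum_mul_neg q M
  rw [isInvPochhammer_q.one] at h1
  simp only [rrTerm, isInvPochhammer_q.one, zero_add]
  generalize invPochhammer q (1 + 1) = G at *
  generalize (∑ i ∈ Finset.range M, q ^ i) = S at *
  generalize recip (1 - t * q ^ (M + 1)) = r at *
  have h4 : 1 + q * S = (1 - q ^ (M + 1)) * G := by
    linear_combination (-(1 + q * S)) * h1 + G * q * h3
  linear_combination (-1 : ℤ[X]⟦X⟧) * h2 + r * h4 + (1 - q ^ (M + 1)) * r * h1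

section Limit

open Filter Topology

theorem tendsto_order_of_dvd {f : ℕ → ℤ[X]⟦X⟧} (h : ∀ n, q ^ (n + 1) ∣ f n) :
    Tendsto (fun n => (f n).order) atTop (𝓝 ⊤) := by
  refine ENat.tendsto_nhds_top_iff_natCast_lt.mpr fun n => eventually_atTop.mpr ⟨n, fun m hm => ?_⟩
  have h1 : ((m + 1 : ℕ) : ℕ∞) ≤ (f m).order :=
    PowerSeries.nat_le_order _ _ (PowerSeries.X_pow_dvd_iff.mp (h m))
  exact lt_of_lt_of_le (by exact_mod_cast Nat.lt_succ_of_le hm) h1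

variable [TopologicalSpace ℤ[X]]

theorem multipliable_prodFactor : Multipliable prodFactor := by
  have h : prodFactor = (1 + (prodFactor · - 1)) := by ext; simp
  rw [h]
  refine PowerSeries.WithPiTopology.multipliable_one_add_of_tendsto_order_atTop_nhds_top _
    (tendsto_order_of_dvd fun n => ?_)
  refine ⟨-q ^ (4 * n) - q ^ (4 * n + 3) + q ^ (9 * n + 4), ?_⟩
  rw [prodFactor]
  ring

theorem summable_rrTerm [IsTopologicalRing ℤ[X]] : Summable rrTerm := by
  rw [← summable_nat_add_iff 1]
  refine PowerSeries.WithPiTopology.summable_of_tendsto_order_atTop_nhds_top _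
    (tendsto_order_of_dvd fun n => ?_)
  exact (pow_dvd_pow q (Nat.le_self_pow two_ne_zero (n + 1))).mul_right _

/-- The first Rogers-Ramanujan identity. -/
theorem tprod_prodFactor_mul_tsum_rrTerm [IsTopologicalRing ℤ[X]] [T2Space ℤ[X]] :
    (∏' n, prodFactor n) * ∑' k, rrTerm k = 1 := by
  have h1 := summable_rrTerm.hasSum.tendsto_sum_nat.comp (tendsto_add_atTop_nat 1)
  have h2 := multipliable_prodFactor.hasProd.tendsto_prod_nat
  refine tendsto_nhds_unique (h2.mul h1) ?_
  rw [PowerSeries.WithPiTopology.tendsto_iff_coeff_tendsto]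
  -- For $n\ge d$ the congruence modulo $q^{n+1}$ already fixes the coefficient of $q^d$.
  refine fun d => tendsto_const_nhds.congr' (eventually_atTop.mpr ⟨d, fun n hn => ?_⟩)
  have h := isInvPochhammer_q.dvd_rogersRamanujan
    (isInvPochhammer_invPochhammer (constantCoeff_q_pow 4)) one_sub_q_pow_ne_zero n
  have h' := PowerSeries.X_pow_dvd_iff.mp h d (by lia)
  rw [map_sub, sub_eq_zero, mul_comm] at h'
  exact h'.symm

end Limit

end Series

end RogersRamanujan

open RogersRamanujan in
theorem mainTheorem4 (M : ℕ) (hM : 1 ≤ M) (hmod : M + 1 ≡ 1 [MOD 5] ∨ M + 1 ≡ 4 [MOD 5]) :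
    letI : TopologicalSpace (Polynomial ℤ) := coeffTopology
    Summable (fun j : ℕ => tailTerm M (M + 1 + j)) ∧
    Multipliable prodFactor ∧
    1 + q * ((∑ i ∈ Finset.range M, q ^ i) + t * q ^ M) * recip (1 - t * q ^ (M + 1))
      + ∑ k ∈ Finset.Icc 2 M, q ^ (k ^ 2) * (qInt (M + 1) * recip (1 - t * q ^ (M + 1)))
          * recip (∏ i ∈ Finset.Icc 2 k, (1 - q ^ i))
      + ∑' j : ℕ, tailTerm M (M + 1 + j)
    = (1 - q ^ (M + 1)) * recip (1 - t * q ^ (M + 1)) * recip (∏' n : ℕ, prodFactor n) := by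
  let : TopologicalSpace (Polynomial ℤ) := coeffTopology
  have : DiscreteTopology (Polynomial ℤ) := ⟨rfl⟩
  have hs : Summable fun j => rrTerm (M + 1 + j) := by
    simp only [add_comm (M + 1)]
    exact (summable_nat_add_iff (M + 1)).mpr summable_rrTerm
  simp only [tailTerm_eq]
  refine ⟨hs.mul_left _, multipliable_prodFactor, ?_⟩
  have hRR := tprod_prodFactor_mul_tsum_rrTerm
  -- Needed for `recip` of the infinite product to be its inverse.
  have hc : PowerSeries.constantCoeff (∏' n, prodFactor n) = 1 := by
    rw [multipliable_prodFactor.map_tprod _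
      (PowerSeries.WithPiTopology.continuous_constantCoeff _)]
    simp [prodFactor, q]
  have hsplit := summable_rrTerm.sum_add_tsum_nat_add (M + 1)
  simp only [add_comm _ (M + 1)] at hsplit
  have hfin : ∑ k ∈ Finset.range (M + 1), rrTerm k
      = rrTerm 0 + rrTerm 1 + ∑ k ∈ Finset.Icc 2 M, rrTerm k := by
    rw [Finset.range_eq_Ico, Finset.sum_eq_sum_Ico_succ_bot (by lia),
      Finset.sum_eq_sum_Ico_succ_bot (by lia), ← add_assoc]
    rfl
  rw [← eq_recip hRR hc, ← hsplit, hfin, initialTerms_eq, hs.tsum_mul_left,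
    Finset.sum_congr rfl fun k hk => middleTerm_eq M k (Finset.mem_Icc.mp hk).1, ← Finset.mul_sum]
  ring
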